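/- Let $K$ be a field, let $n\ge 1$, and let $R=K[x_{ij},y_j \mid 1\le i,j\le n]$ be the polynomial ring in $n^2+n$ independent indeterminates. Let $X=(x_{ij})$ be the generic $n\times n$ matrix, let $\Delta=\det X$, and let $g_i=\sum_{j=1}^n x_{ij}y_j$ for $1\le i\le n$ be the entries of the product of $X$ with the column vector $(y_1,\dots,y_n)^{T}$. Then the ideal $\langle g_1,\dots,g_n,\Delta\rangle$ of $R$ is prime. Moreover, it equals the saturation of $\langle g_1,\dots,g_n\rangle$ with respect to $y_n$: $$\langle g_1,\dots,g_n,\Delta\rangle=[g_1,\dots,g_n]:=\{f\in R \mid f\,y_n^{e}\in\langle g_1,\dots,g_n\rangle\ \text{for some integer } e\ge 0\}.$$ -/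

import Mathlib

open MvPolynomial

/-- The polynomial ring `R = K[x_ij, y_j]`, `1 ≤ i, j ≤ n`: the variable `Sum.inl (i, j)` is
`x_ij` and the variable `Sum.inr j` is `y_j` (indices are counted from `0`). -/
abbrev GenericRing (K : Type*) [Field K] (n : ℕ) : Type _ :=
  MvPolynomial ((Fin n × Fin n) ⊕ Fin n) K

section

variable (K : Type*) [Field K] (n : ℕ)

/-- The generic `n × n` matrix `X = (x_ij)`. -/
noncomputable def genericX : Matrix (Fin n) (Fin n) (GenericRing K n) :=
  Matrix.of fun i j => X (Sum.inl (i, j))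

/-- The generic column vector `Y = (y_j)`. -/
noncomputable def genericY : Fin n → GenericRing K n :=
  fun j => X (Sum.inr j)

/-- The entries `g_i = ∑_j x_ij y_j` of the product `X Y`. -/
noncomputable def genericG : Fin n → GenericRing K n :=
  Matrix.mulVec (genericX K n) (genericY K n)

/-- The determinant `Δ` of the generic matrix `X`. -/
noncomputable def genericDelta : GenericRing K n :=
  (genericX K n).det

end

/-- The saturation `{f | f * a ^ e ∈ I for some integer e ≥ 0}` of the ideal `I` with respect to
the element `a`. -/
def idealSaturation {R : Type*} [CommRing R] (I : Ideal R) (a : R) : Ideal R where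
  carrier := {f | ∃ e : ℕ, f * a ^ e ∈ I}
  zero_mem' := ⟨0, by simp⟩
  add_mem' := by
    rintro f g ⟨d, hd⟩ ⟨e, he⟩
    refine ⟨d + e, ?_⟩
    have h : (f + g) * a ^ (d + e) = a ^ e * (f * a ^ d) + a ^ d * (g * a ^ e) := by ring
    rw [h]
    exact I.add_mem (I.mul_mem_left _ hd) (I.mul_mem_left _ he)
  smul_mem' := by
    rintro c f ⟨e, he⟩
    refine ⟨e, ?_⟩
    rw [smul_eq_mul, mul_assoc]
    exact I.mul_mem_left c he

/-! Where y_n is invertible, the equations g_i = 0 can be solved for the last column of X. So the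
saturation at y_n is the kernel of a substitution into a field (`elim`), hence prime, and by
Cramer's rule it contains Δ.

It remains to strip powers of y_n: y_n f ∈ ⟨g⟩ must force f ∈ ⟨g, Δ⟩
(`mem_rowDetIdeal_of_y_mul_mem_of_colon`). Setting y_n = 0 turns a relation among the forms into one
with a column fewer. There, by induction on the number of columns, a multiplier taking the next form
into the ideal of the first k lies in that ideal, enlarged by the determinant if k equals the number
of columns (`mem_rowDetIdeal_of_mul_rowForm_mem`). That statement varies the size and uses a row
below the square matrix, hence the indeterminates indexed by ℕ. -/

theorem MvPolynomial.sub_mem_of_X_sub_mem {σ K : Type*} [CommRing K]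
    (ψ : MvPolynomial σ K →ₐ[K] MvPolynomial σ K) (I : Ideal (MvPolynomial σ K))
    (h : ∀ v, X v - ψ (X v) ∈ I) (f : MvPolynomial σ K) : f - ψ f ∈ I := by
  have key : (Ideal.Quotient.mkₐ K I).comp ψ = Ideal.Quotient.mkₐ K I := by
    ext v
    exact (Ideal.Quotient.eq.2 (h v)).symm
  exact Ideal.Quotient.eq.1 (DFunLike.congr_fun key f).symm

theorem Matrix.det_mul_mem_span_mulVec {ι R : Type*} [Fintype ι] [DecidableEq ι] [CommRing R]
    (M : Matrix ι ι R) (y : ι → R) (j : ι) :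
    M.det * y j ∈ Ideal.span (Set.range (M.mulVec y)) := by
  have h : (M.adjugate.mulVec (M.mulVec y)) j = M.det * y j := by
    rw [Matrix.mulVec_mulVec, Matrix.adjugate_mul, Matrix.smul_mulVec, Matrix.one_mulVec]
    rfl
  rw [← h]
  exact Ideal.sum_mem _ fun i _ => Ideal.mul_mem_left _ _ (Ideal.subset_span ⟨i, rfl⟩)

/-- The polynomial ring in infinitely many indeterminates `x_ij`, `y_j`, `i, j ∈ ℕ`. -/
abbrev NatGenericRing (K : Type*) [Field K] : Type _ :=
  MvPolynomial ((ℕ × ℕ) ⊕ ℕ) K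

namespace NatGenericRing

variable (K : Type*) [Field K]

/-- The indeterminate `x_ij`. -/
noncomputable abbrev x (i j : ℕ) : NatGenericRing K := X (Sum.inl (i, j))

/-- The indeterminate `y_j`. -/
noncomputable abbrev y (j : ℕ) : NatGenericRing K := X (Sum.inr j)

/-- The form `∑_{j < n} x_ij y_j`. -/
noncomputable def rowForm (n i : ℕ) : NatGenericRing K :=
  ∑ j ∈ Finset.range n, x K i j * y K j

/-- The ideal generated by the first `k` forms in `n` columns. -/
noncomputable def rowIdeal (n k : ℕ) : Ideal (NatGenericRing K) :=
  Ideal.span (rowForm K n '' Set.Iio k)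

/-- The generic `n × n` matrix. -/
noncomputable def mat (n : ℕ) : Matrix (Fin n) (Fin n) (NatGenericRing K) :=
  Matrix.of fun i j => x K i j

/-- The ideal generated by the first `k` forms in `n` columns, and by the determinant of the
generic `n × n` matrix if `k = n`. -/
noncomputable def rowDetIdeal (n k : ℕ) : Ideal (NatGenericRing K) :=
  rowIdeal K n k ⊔ if k = n then Ideal.span {(mat K n).det} else ⊥

variable {K}

/-! ### Row forms and Cramer's rule -/

theorem rowForm_mem {n k i : ℕ} (h : i < k) : rowForm K n i ∈ rowIdeal K n k :=
  Ideal.subset_span ⟨i, h, rfl⟩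

theorem rowForm_succ (n i : ℕ) : rowForm K (n + 1) i = rowForm K n i + x K i n * y K n :=
  Finset.sum_range_succ _ _

theorem rowIdeal_zero (n : ℕ) : rowIdeal K n 0 = ⊥ := by
  simp [rowIdeal]

theorem rowIdeal_succ (n k : ℕ) :
    rowIdeal K n (k + 1) = Ideal.span {rowForm K n k} ⊔ rowIdeal K n k := by
  rw [rowIdeal, rowIdeal, ← Ideal.span_union]
  congr 1
  ext f
  simp only [Set.mem_image, Set.mem_Iio, Set.singleton_union, Set.mem_insert_iff,
    Nat.lt_succ_iff_lt_or_eq]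
  constructor
  · rintro ⟨i, h | rfl, rfl⟩
    · exact Or.inr ⟨i, h, rfl⟩
    · exact Or.inl rfl
  · rintro (rfl | ⟨i, h, rfl⟩)
    · exact ⟨k, Or.inr rfl, rfl⟩
    · exact ⟨i, Or.inl h, rfl⟩

theorem rowIdeal_le_rowDetIdeal (n k : ℕ) : rowIdeal K n k ≤ rowDetIdeal K n k :=
  le_sup_left

theorem rowDetIdeal_of_ne {n k : ℕ} (h : k ≠ n) : rowDetIdeal K n k = rowIdeal K n k := by
  simp [rowDetIdeal, h]

theorem rowDetIdeal_self (n : ℕ) :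
    rowDetIdeal K n n = rowIdeal K n n ⊔ Ideal.span {(mat K n).det} := by
  simp [rowDetIdeal]

theorem mat_mulVec (n : ℕ) (i : Fin n) :
    (mat K n).mulVec (fun j => y K j) i = rowForm K n i :=
  Fin.sum_univ_eq_sum_range (fun j => x K i j * y K j) n

theorem span_range_mulVec (n : ℕ) :
    Ideal.span (Set.range ((mat K n).mulVec fun j => y K j)) = rowIdeal K n n := by
  rw [rowIdeal]
  congr 1
  ext f
  constructor
  · rintro ⟨i, rfl⟩
    exact ⟨i, i.2, (mat_mulVec n i).symm⟩
  · rintro ⟨i, hi, rfl⟩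
    exact ⟨⟨i, hi⟩, mat_mulVec n ⟨i, hi⟩⟩

theorem det_mul_y_mem {n j : ℕ} (h : j < n) : (mat K n).det * y K j ∈ rowIdeal K n n := by
  rw [← span_range_mulVec]
  exact Matrix.det_mul_mem_span_mulVec (mat K n) (fun j => y K j) ⟨j, h⟩

/-- Last coordinate of adj(X)(XY) = det(X)Y, whose corner cofactor is the smaller determinant. This
lets the determinant of size m + 1 enter the induction. -/
theorem det_mul_rowForm_sub_mem (m : ℕ) :
    (mat K m).det * rowForm K (m + 1) m - y K m * (mat K (m + 1)).det ∈
      rowIdeal K (m + 1) m := by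
  have h : ((mat K (m + 1)).adjugate.mulVec ((mat K (m + 1)).mulVec fun j => y K j))
      (Fin.last m) = (mat K (m + 1)).det * y K m := by
    rw [Matrix.mulVec_mulVec, Matrix.adjugate_mul, Matrix.smul_mulVec, Matrix.one_mulVec]
    simp
  have hadj : (mat K (m + 1)).adjugate (Fin.last m) (Fin.last m) = (mat K m).det := by
    rw [Matrix.adjugate_fin_succ_eq_det_submatrix, Fin.succAbove_last]
    have : (mat K (m + 1)).submatrix Fin.castSucc Fin.castSucc = mat K m := by
      ext i j
      rfl
    rw [this, ← two_mul, pow_mul]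
    simp
  rw [Matrix.mulVec, dotProduct, Fin.sum_univ_castSucc, hadj, mat_mulVec] at h
  have h' : (mat K m).det * rowForm K (m + 1) m - y K m * (mat K (m + 1)).det =
      -∑ i : Fin m, (mat K (m + 1)).adjugate (Fin.last m) i.castSucc *
        (mat K (m + 1)).mulVec (fun j => y K j) i.castSucc := by
    rw [Fin.val_last] at h
    linear_combination h
  rw [h']
  refine neg_mem (Ideal.sum_mem _ fun i _ => Ideal.mul_mem_left _ _ ?_)
  rw [mat_mulVec]
  exact rowForm_mem i.2

theorem det_mat_ne_zero (n : ℕ) : (mat K n).det ≠ 0 := by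
  intro h
  have h' := congrArg (aeval (R := K) (fun v : (ℕ × ℕ) ⊕ ℕ =>
    Sum.elim (fun p => if p.1 = p.2 then (1 : K) else 0) (fun _ => 0) v)) h
  rw [AlgHom.map_det, map_zero] at h'
  have : (aeval (R := K) (fun v : (ℕ × ℕ) ⊕ ℕ =>
      Sum.elim (fun p => if p.1 = p.2 then (1 : K) else 0) (fun _ => 0) v)).mapMatrix
      (mat K n) = 1 := by
    ext i j
    simp [mat, Matrix.one_apply, Fin.ext_iff]
  rw [this, Matrix.det_one] at h'
  exact one_ne_zero h'

theorem rowForm_ne_zero (m i : ℕ) : rowForm K (m + 1) i ≠ 0 := by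
  intro h
  have h' := congrArg (aeval (R := K) (fun v : (ℕ × ℕ) ⊕ ℕ =>
    Sum.elim (fun p => if p.2 = m then (1 : K) else 0) (fun _ => 1) v)) h
  simp [rowForm] at h'

/-! ### Setting some y_j to zero -/

/-- Setting the indeterminates `y_j`, `j ∈ s`, equal to zero. -/
noncomputable def kill (K : Type*) [Field K] (s : Finset ℕ) :
    NatGenericRing K →ₐ[K] NatGenericRing K :=
  aeval (Sum.elim (fun p => X (Sum.inl p)) (fun j => if j ∈ s then 0 else y K j))

theorem kill_x (s : Finset ℕ) (i j : ℕ) : kill K s (x K i j) = x K i j := by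
  simp [kill]

theorem kill_y (s : Finset ℕ) (j : ℕ) :
    kill K s (y K j) = if j ∈ s then 0 else y K j := by
  simp [kill]

theorem sub_kill_mem (s : Finset ℕ) (f : NatGenericRing K) :
    f - kill K s f ∈ Ideal.span (y K '' s) := by
  refine MvPolynomial.sub_mem_of_X_sub_mem _ _ ?_ f
  rintro (⟨i, j⟩ | j)
  · have := kill_x (K := K) s i j
    simp [this]
  · have := kill_y (K := K) s j
    rw [this]
    split_ifs with h
    · rw [sub_zero]
      exact Ideal.subset_span ⟨j, h, rfl⟩
    · simp

theorem kill_det (s : Finset ℕ) (n : ℕ) : kill K s (mat K n).det = (mat K n).det := by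
  rw [AlgHom.map_det]
  congr 1
  ext i j
  simp [mat, kill_x]

theorem kill_range_rowForm (n i : ℕ) : kill K (Finset.range n) (rowForm K n i) = 0 := by
  rw [rowForm, map_sum]
  refine Finset.sum_eq_zero fun j hj => ?_
  rw [map_mul, kill_y, if_pos hj, mul_zero]

theorem kill_singleton_rowForm (m i : ℕ) :
    kill K {m} (rowForm K (m + 1) i) = rowForm K m i := by
  rw [rowForm_succ, map_add, map_mul, kill_y, if_pos (Finset.mem_singleton_self m), mul_zero,
    add_zero, rowForm, map_sum]
  refine Finset.sum_congr rfl fun j hj => ?_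
  rw [map_mul, kill_y, kill_x, if_neg]
  rw [Finset.mem_singleton]
  exact (Finset.mem_range.1 hj).ne

/-- Setting all y_j, j ≤ m, to zero kills the forms but not the determinant. So the coefficient of
the determinant lies in the ideal of these y_j, and Cramer's rule absorbs the product. -/
theorem mem_rowIdeal_of_y_mul_mem_rowDetIdeal {m k : ℕ} {f : NatGenericRing K}
    (h : y K m * f ∈ rowDetIdeal K (m + 1) k) : y K m * f ∈ rowIdeal K (m + 1) k := by
  by_cases hk : k = m + 1
  swap
  · rwa [rowDetIdeal_of_ne hk] at h
  subst hk
  rw [rowDetIdeal_self, Submodule.mem_sup] at h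
  obtain ⟨a, ha, c, hc, hac⟩ := h
  obtain ⟨b, rfl⟩ := Ideal.mem_span_singleton'.1 hc
  have hle : rowIdeal K (m + 1) (m + 1) ≤ RingHom.ker (kill K (Finset.range (m + 1))) := by
    rw [rowIdeal, Ideal.span_le]
    rintro _ ⟨i, -, rfl⟩
    exact kill_range_rowForm (m + 1) i
  have h0 := congrArg (kill K (Finset.range (m + 1))) hac
  rw [map_add, show kill K (Finset.range (m + 1)) a = 0 from hle ha, zero_add, map_mul, kill_det,
    map_mul, kill_y, if_pos (Finset.self_mem_range_succ m), zero_mul, mul_eq_zero,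
    or_iff_left (det_mat_ne_zero (m + 1))] at h0
  have hb := sub_kill_mem (Finset.range (m + 1)) b
  rw [h0, sub_zero] at hb
  rw [← hac]
  refine add_mem ha ?_
  refine Submodule.span_induction (p := fun b _ => b * (mat K (m + 1)).det ∈
    rowIdeal K (m + 1) (m + 1)) ?_ ?_ ?_ ?_ hb
  · rintro _ ⟨j, hj, rfl⟩
    rw [mul_comm]
    exact det_mul_y_mem (Finset.mem_range.1 hj)
  · simp
  · intro u v _ _ hu hv
    rw [add_mul]
    exact add_mem hu hv
  · intro r u _ hu
    rw [smul_eq_mul, mul_assoc]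
    exact Ideal.mul_mem_left _ _ hu

/-! ### Saturation at y_m as a prime kernel -/

/-- The elimination of `x_im`, `i < k`, by means of the equations `∑_{j ≤ m} x_ij y_j = 0`. -/
noncomputable def elim (K : Type*) [Field K] (m k : ℕ) :
    NatGenericRing K →ₐ[K] FractionRing (NatGenericRing K) :=
  aeval (Sum.elim
    (fun p => if p.2 = m ∧ p.1 < k then
        -algebraMap _ (FractionRing (NatGenericRing K)) (rowForm K m p.1) /
          algebraMap _ (FractionRing (NatGenericRing K)) (y K m)
      else algebraMap _ _ (x K p.1 p.2))
    (fun j => algebraMap _ _ (y K j)))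

theorem elim_y (m k j : ℕ) : elim K m k (y K j) = algebraMap _ _ (y K j) := by
  simp [elim]

theorem elim_x {m k i j : ℕ} (h : ¬(j = m ∧ i < k)) :
    elim K m k (x K i j) = algebraMap _ _ (x K i j) := by
  simp only [elim, aeval_X, Sum.elim_inl, if_neg h]

theorem elim_x_mul_y {m k i : ℕ} (h : i < k) :
    elim K m k (x K i m) * algebraMap _ _ (y K m) = -algebraMap _ _ (rowForm K m i) := by
  have hy : algebraMap _ (FractionRing (NatGenericRing K)) (y K m) ≠ 0 := by
    rw [Ne, FaithfulSMul.algebraMap_eq_zero_iff]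
    exact X_ne_zero _
  simp only [elim, aeval_X, Sum.elim_inl, h, and_self, if_true]
  rw [div_mul_cancel₀ _ hy]

theorem elim_rowForm (m k i : ℕ) :
    elim K m k (rowForm K m i) = algebraMap _ _ (rowForm K m i) := by
  rw [rowForm, map_sum, map_sum]
  refine Finset.sum_congr rfl fun j hj => ?_
  rw [map_mul, map_mul, elim_y, elim_x]
  exact fun h => (Finset.mem_range.1 hj).ne h.1

theorem ker_elim_isPrime (m k : ℕ) : (RingHom.ker (elim K m k)).IsPrime :=
  RingHom.ker_isPrime (elim K m k).toRingHom

theorem rowIdeal_le_ker_elim (m k : ℕ) :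
    rowIdeal K (m + 1) k ≤ RingHom.ker (elim K m k) := by
  rw [rowIdeal, Ideal.span_le]
  rintro _ ⟨i, hi, rfl⟩
  change elim K m k _ = 0
  rw [rowForm_succ, map_add, map_mul, elim_rowForm, elim_y, elim_x_mul_y hi, add_neg_cancel]

/-- Only rows below `k` are eliminated, so `elim` merely embeds this nonzero form. -/
theorem rowForm_notMem_ker_elim (m k : ℕ) :
    rowForm K (m + 1) k ∉ RingHom.ker (elim K m k) := by
  intro h
  change elim K m k _ = 0 at h
  rw [rowForm_succ, map_add, map_mul, elim_rowForm, elim_y, elim_x (by simp), ← map_mul,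
    ← map_add, ← rowForm_succ, FaithfulSMul.algebraMap_eq_zero_iff] at h
  exact rowForm_ne_zero m k h

/-- Modulo the forms, y_m x_im is minus the form of row i in m columns. Hence a power of y_m clears
the eliminated indeterminates from f, and `elim` embeds what remains. -/
theorem exists_y_pow_mul_sub_mem (m k : ℕ) (f : NatGenericRing K) :
    ∃ (e : ℕ) (h : NatGenericRing K),
      y K m ^ e * f - h ∈ rowIdeal K (m + 1) k ∧ elim K m k h = algebraMap _ _ h := by
  induction f using MvPolynomial.induction_on with
  | C a =>
    refine ⟨0, C a, by rw [pow_zero, one_mul, sub_self]; exact zero_mem _, ?_⟩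
    change elim K m k (algebraMap K (NatGenericRing K) a) =
      algebraMap _ _ (algebraMap K (NatGenericRing K) a)
    rw [AlgHom.commutes, ← IsScalarTower.algebraMap_apply]
  | add f g hf hg =>
    obtain ⟨d, p, hp, hp'⟩ := hf
    obtain ⟨e, q, hq, hq'⟩ := hg
    refine ⟨d + e, y K m ^ e * p + y K m ^ d * q, ?_, ?_⟩
    · have h := add_mem (Ideal.mul_mem_left _ (y K m ^ e) hp)
        (Ideal.mul_mem_left _ (y K m ^ d) hq)
      convert h using 1
      ring
    · simp only [map_add, map_mul, map_pow, elim_y, hp', hq']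
  | mul_X f v hf =>
    obtain ⟨e, p, hp, hp'⟩ := hf
    by_cases hv : elim K m k (X v) = algebraMap (NatGenericRing K) _ (X v)
    · refine ⟨e, p * X v, ?_, by rw [map_mul, map_mul, hp', hv]⟩
      convert Ideal.mul_mem_left _ (X v) hp using 1
      ring
    · obtain ⟨i, j⟩ | j := v
      swap
      · exact absurd (elim_y m k j) hv
      obtain ⟨rfl, hi⟩ : j = m ∧ i < k := by
        by_contra h
        exact hv (elim_x h)
      refine ⟨e + 1, -(p * rowForm K j i), ?_, ?_⟩
      · have h := add_mem (Ideal.mul_mem_left _ (y K j * x K i j) hp)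
          (Ideal.mul_mem_left _ p (rowForm_mem (K := K) (n := j + 1) hi))
        convert h using 1
        rw [rowForm_succ]
        ring
      · rw [map_neg, map_neg, map_mul, map_mul, hp', elim_rowForm]

theorem mem_ker_elim_iff (m k : ℕ) (f : NatGenericRing K) :
    f ∈ RingHom.ker (elim K m k) ↔ ∃ e : ℕ, f * y K m ^ e ∈ rowIdeal K (m + 1) k := by
  constructor
  · intro hf
    obtain ⟨e, p, hp, hp'⟩ := exists_y_pow_mul_sub_mem m k f
    have h0 := rowIdeal_le_ker_elim m k hp
    rw [RingHom.mem_ker, map_sub, map_mul, RingHom.mem_ker.1 hf, mul_zero, zero_sub, neg_eq_zero,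
      hp', FaithfulSMul.algebraMap_eq_zero_iff] at h0
    exact ⟨e, by simpa [h0, mul_comm] using hp⟩
  · rintro ⟨e, he⟩
    refine ((ker_elim_isPrime m k).mem_or_mem (rowIdeal_le_ker_elim m k he)).resolve_right ?_
    intro h
    have h' := (ker_elim_isPrime m k).mem_of_pow_mem _ h
    rw [RingHom.mem_ker, elim_y, FaithfulSMul.algebraMap_eq_zero_iff] at h'
    exact X_ne_zero _ h'

/-! ### Stripping powers of y_m -/

theorem mem_rowDetIdeal_of_mul_y_pow_mem {m k : ℕ}
    (H : ∀ f, y K m * f ∈ rowIdeal K (m + 1) k → f ∈ rowDetIdeal K (m + 1) k)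
    {f : NatGenericRing K} {e : ℕ} (h : f * y K m ^ e ∈ rowIdeal K (m + 1) k) :
    f ∈ rowDetIdeal K (m + 1) k := by
  -- `H` returns only the larger ideal, so the induction on `e` runs there; a remaining factor y_m
  -- brings membership back to the smaller ideal.
  replace h := rowIdeal_le_rowDetIdeal _ _ h
  induction e with
  | zero => simpa using h
  | succ e ih =>
    refine ih (H _ (mem_rowIdeal_of_y_mul_mem_rowDetIdeal ?_))
    convert h using 1
    ring

theorem mem_rowDetIdeal_of_y_mul_mem_of_colon {m k : ℕ} (hk : k ≤ m + 1)
    (H : ∀ k ≤ m, ∀ a, a * rowForm K m k ∈ rowIdeal K m k → a ∈ rowDetIdeal K m k)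
    (f : NatGenericRing K) (hf : y K m * f ∈ rowIdeal K (m + 1) k) :
    f ∈ rowDetIdeal K (m + 1) k := by
  induction k generalizing f with
  | zero =>
    rw [rowIdeal_zero, Ideal.mem_bot, mul_eq_zero, or_iff_right (X_ne_zero _)] at hf
    rw [hf]
    exact zero_mem _
  | succ k ih =>
    rw [rowIdeal_succ, Ideal.mem_span_singleton_sup] at hf
    obtain ⟨a, b, hb, hab⟩ := hf
    have hle : rowIdeal K (m + 1) k ≤ (rowIdeal K m k).comap (kill K {m}) := by
      rw [rowIdeal, Ideal.span_le]
      rintro _ ⟨i, hi, rfl⟩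
      change kill K {m} _ ∈ rowIdeal K m k
      rw [kill_singleton_rowForm]
      exact rowForm_mem hi
    have hle' : rowIdeal K m k ≤ rowIdeal K (m + 1) k ⊔ Ideal.span {y K m} := by
      rw [rowIdeal, Ideal.span_le]
      rintro _ ⟨i, hi, rfl⟩
      rw [eq_sub_of_add_eq (rowForm_succ (K := K) m i).symm]
      exact sub_mem (Ideal.mem_sup_left (rowForm_mem hi))
        (Ideal.mem_sup_right (Ideal.mul_mem_left _ _ (Ideal.mem_span_singleton_self _)))
    -- At y_m = 0 the relation `hab` has one column fewer, so `H` applies.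
    have hka : kill K {m} a ∈ rowDetIdeal K m k := by
      refine H k (by omega) _ ?_
      have h0 := congrArg (kill K {m}) hab
      rw [map_add, map_mul, map_mul, kill_singleton_rowForm, kill_y,
        if_pos (Finset.mem_singleton_self m), zero_mul] at h0
      rw [eq_neg_of_add_eq_zero_left h0]
      exact neg_mem (hle hb)
    have ha : a - kill K {m} a ∈ Ideal.span {y K m} := by
      simpa using sub_kill_mem {m} a
    -- Modulo the first k forms, a is c y_m + d, with d a multiple of the determinant of size m if k
    -- = m and zero otherwise. Then d times the next form is y_m p.
    have hdec : ∃ c d, a - c * y K m - d ∈ rowIdeal K (m + 1) k ∧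
        ∃ p ∈ rowDetIdeal K (m + 1) (k + 1),
          d * rowForm K (m + 1) k - y K m * p ∈ rowIdeal K (m + 1) k := by
      obtain ⟨u, hu⟩ := Ideal.mem_span_singleton'.1 ha
      obtain ⟨q, hq, d, hd, hqd⟩ := Submodule.mem_sup.1 hka
      obtain ⟨r, hr, s, hs, hrs⟩ := Submodule.mem_sup.1 (hle' hq)
      obtain ⟨t, rfl⟩ := Ideal.mem_span_singleton'.1 hs
      refine ⟨u + t, d, ?_, ?_⟩
      · convert hr using 1
        linear_combination -hu - hqd - hrs
      · split_ifs at hd with hkm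
        · subst hkm
          obtain ⟨w, rfl⟩ := Ideal.mem_span_singleton'.1 hd
          refine ⟨w * (mat K (k + 1)).det, ?_, ?_⟩
          · rw [rowDetIdeal_self]
            exact Ideal.mem_sup_right (Ideal.mul_mem_left _ _ (Ideal.mem_span_singleton_self _))
          · convert Ideal.mul_mem_left _ w (det_mul_rowForm_sub_mem (K := K) k) using 1
            ring
        · rw [Ideal.mem_bot] at hd
          subst hd
          exact ⟨0, zero_mem _, by simp⟩
    obtain ⟨c, d, hcd, p, hp, hdp⟩ := hdec
    have hlt : k ≠ m + 1 := by omega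
    -- Substituting for a in `hab` leaves y_m times this difference in the ideal of the first k
    -- forms.
    have hsub := ih (by omega) (f - c * rowForm K (m + 1) k - p) (by
      have h := add_mem (add_mem hb hdp) (Ideal.mul_mem_left _ (rowForm K (m + 1) k) hcd)
      convert h using 1
      linear_combination -hab)
    rw [rowDetIdeal_of_ne hlt] at hsub
    have hmono : rowIdeal K (m + 1) k ≤ rowDetIdeal K (m + 1) (k + 1) :=
      le_trans (by rw [rowIdeal_succ]; exact le_sup_right) (rowIdeal_le_rowDetIdeal _ _)
    have h := add_mem (add_mem (hmono hsub) hp) (Ideal.mul_mem_left _ c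
      (rowIdeal_le_rowDetIdeal _ _ (rowForm_mem (K := K) (n := m + 1) (Nat.lt_succ_self k))))
    convert h using 1
    ring

theorem mem_rowDetIdeal_of_mul_rowForm_mem {n k : ℕ} (hk : k ≤ n) (a : NatGenericRing K)
    (ha : a * rowForm K n k ∈ rowIdeal K n k) : a ∈ rowDetIdeal K n k := by
  induction n generalizing k a with
  | zero =>
    -- The empty determinant is 1, so the enlarged ideal is the whole ring.
    obtain rfl : k = 0 := by omega
    rw [rowDetIdeal_self, Matrix.det_isEmpty, Ideal.span_singleton_one, sup_top_eq]
    trivial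
  | succ m ih =>
    -- The next form avoids the prime kernel, so a lies in the saturation at y_m.
    have h := ((ker_elim_isPrime m k).mem_or_mem (rowIdeal_le_ker_elim m k ha)).resolve_right
      (rowForm_notMem_ker_elim m k)
    obtain ⟨e, he⟩ := (mem_ker_elim_iff m k a).1 h
    exact mem_rowDetIdeal_of_mul_y_pow_mem
      (mem_rowDetIdeal_of_y_mul_mem_of_colon hk fun k hk a => ih hk a) he

theorem mem_rowDetIdeal_self_of_mul_y_pow_mem {m e : ℕ} {f : NatGenericRing K}
    (h : f * y K m ^ e ∈ rowIdeal K (m + 1) (m + 1)) : f ∈ rowDetIdeal K (m + 1) (m + 1) :=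
  mem_rowDetIdeal_of_mul_y_pow_mem (mem_rowDetIdeal_of_y_mul_mem_of_colon le_rfl
    fun _ hk a => mem_rowDetIdeal_of_mul_rowForm_mem hk a) h

/-! ### Descent to finitely many indeterminates -/

variable (K) in
/-- The inclusion of the polynomial ring of the generic `n × n` matrix and vector. -/
noncomputable def incl (n : ℕ) : GenericRing K n →ₐ[K] NatGenericRing K :=
  rename (Sum.map (Prod.map Fin.val Fin.val) Fin.val)

variable (K) in
/-- The retraction of `incl` that sends the indeterminates outside of its range to zero. -/
noncomputable def retract (n : ℕ) : NatGenericRing K →ₐ[K] GenericRing K n :=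
  aeval (Sum.elim
    (fun p => if h : p.1 < n ∧ p.2 < n then X (Sum.inl (⟨p.1, h.1⟩, ⟨p.2, h.2⟩)) else 0)
    (fun j => if h : j < n then X (Sum.inr ⟨j, h⟩) else 0))

theorem retract_incl (n : ℕ) (f : GenericRing K n) : retract K n (incl K n f) = f := by
  have h : (retract K n).comp (incl K n) = AlgHom.id K _ := by
    ext v
    obtain ⟨i, j⟩ | j := v <;> simp [retract, incl]
  exact DFunLike.congr_fun h f

theorem incl_genericY (n : ℕ) (j : Fin n) : incl K n (genericY K n j) = y K j := by
  simp [incl, genericY]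

theorem incl_genericG (n : ℕ) (i : Fin n) : incl K n (genericG K n i) = rowForm K n i := by
  rw [← mat_mulVec]
  simp [genericG, Matrix.mulVec, dotProduct, incl, genericX, genericY, mat]

theorem incl_genericDelta (n : ℕ) : incl K n (genericDelta K n) = (mat K n).det := by
  rw [genericDelta, AlgHom.map_det]
  congr 1
  ext i j
  simp [incl, genericX, mat]

theorem retract_mem_of_mem_rowIdeal {n : ℕ} {f : NatGenericRing K} (h : f ∈ rowIdeal K n n) :
    retract K n f ∈ Ideal.span (Set.range (genericG K n)) := by
  have hle : rowIdeal K n n ≤ (Ideal.span (Set.range (genericG K n))).comap (retract K n) := by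
    rw [rowIdeal, Ideal.span_le]
    rintro _ ⟨i, hi, rfl⟩
    refine Ideal.subset_span ⟨⟨i, hi⟩, ?_⟩
    rw [← retract_incl n (genericG K n ⟨i, hi⟩), incl_genericG]
  exact hle h

theorem incl_mem_rowIdeal_iff (n : ℕ) (f : GenericRing K n) :
    incl K n f ∈ rowIdeal K n n ↔ f ∈ Ideal.span (Set.range (genericG K n)) := by
  constructor
  · intro h
    rw [← retract_incl n f]
    exact retract_mem_of_mem_rowIdeal h
  · intro h
    have hle : Ideal.span (Set.range (genericG K n)) ≤ (rowIdeal K n n).comap (incl K n) := by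
      rw [Ideal.span_le]
      rintro _ ⟨i, rfl⟩
      change incl K n _ ∈ rowIdeal K n n
      rw [incl_genericG]
      exact rowForm_mem i.2
    exact hle h

theorem mem_span_of_incl_mem_rowDetIdeal (n : ℕ) (f : GenericRing K n)
    (h : incl K n f ∈ rowDetIdeal K n n) :
    f ∈ Ideal.span (Set.range (genericG K n) ∪ {genericDelta K n}) := by
  rw [rowDetIdeal_self, sup_comm, Ideal.mem_span_singleton_sup] at h
  obtain ⟨a, b, hb, hab⟩ := h
  have h0 := congrArg (retract K n) hab
  rw [retract_incl, map_add, map_mul, ← incl_genericDelta, retract_incl] at h0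
  rw [← h0]
  exact add_mem (Ideal.mul_mem_left _ _ (Ideal.subset_span (Or.inr rfl)))
    (Ideal.span_mono Set.subset_union_left (retract_mem_of_mem_rowIdeal hb))

end NatGenericRing

open NatGenericRing in
theorem mainTheorem4 (K : Type*) [Field K] (n : ℕ) (hn : 0 < n) :
    (Ideal.span (Set.range (genericG K n) ∪ {genericDelta K n})).IsPrime ∧
      Ideal.span (Set.range (genericG K n) ∪ {genericDelta K n}) =
        idealSaturation (Ideal.span (Set.range (genericG K n)))
          (genericY K n ⟨n - 1, Nat.sub_lt hn Nat.one_pos⟩) := by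
  obtain ⟨m, rfl⟩ : ∃ m, n = m + 1 := ⟨n - 1, by omega⟩
  have hy : incl K (m + 1) (genericY K (m + 1) ⟨m + 1 - 1, Nat.sub_lt hn Nat.one_pos⟩) =
      y K m := incl_genericY _ _
  have hsat : idealSaturation (Ideal.span (Set.range (genericG K (m + 1))))
      (genericY K (m + 1) ⟨m + 1 - 1, Nat.sub_lt hn Nat.one_pos⟩) =
      (RingHom.ker (elim K m (m + 1))).comap (incl K (m + 1)) := by
    ext f
    rw [Ideal.mem_comap, mem_ker_elim_iff]
    refine exists_congr fun e => ?_
    rw [← incl_mem_rowIdeal_iff, map_mul, map_pow, hy]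
  have heq : Ideal.span (Set.range (genericG K (m + 1)) ∪ {genericDelta K (m + 1)}) =
      idealSaturation (Ideal.span (Set.range (genericG K (m + 1))))
        (genericY K (m + 1) ⟨m + 1 - 1, Nat.sub_lt hn Nat.one_pos⟩) := by
    refine le_antisymm ?_ ?_
    · rw [Ideal.span_le]
      rintro f (hf | rfl)
      · exact ⟨0, by simpa using Ideal.subset_span hf⟩
      · refine ⟨1, ?_⟩
        rw [pow_one]
        exact Matrix.det_mul_mem_span_mulVec _ _ _
    · rintro f ⟨e, he⟩
      rw [← incl_mem_rowIdeal_iff, map_mul, map_pow, hy] at he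
      exact mem_span_of_incl_mem_rowDetIdeal _ _ (mem_rowDetIdeal_self_of_mul_y_pow_mem he)
  refine ⟨?_, heq⟩
  rw [heq, hsat]
  have := ker_elim_isPrime (K := K) m (m + 1)
  exact Ideal.comap_isPrime _ _
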